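/- Let $\ell$ be a positive integer and let $\alpha,\beta,\gamma\in\mathbb Z^3$ be pairwise orthogonal vectors of Euclidean length $\ell$, so that they span a cube $C_\ell$ with vertices in $\mathbb Z^3$ and one vertex at the origin. Let $T_\ell$ be either of the two regular tetrahedra inscribed in this cube, with vertices $0,\alpha+\beta,\beta+\gamma,\gamma+\alpha$ or $\alpha,\beta,\gamma,\alpha+\beta+\gamma$. Let $O_\ell$ be the regular octahedron with vertices $\pm\alpha,\pm\beta,\pm\gamma$, or the one whose vertices are the centres of the faces of the doubled cube $2C_\ell$. For a lattice polytope $P\subset\mathbb R^3$ let $L(P,t)$ be its Ehrhart polynomial, that is, the polynomial in $\mathbb Q[t]$ with $L(P,t)=\#(tP\cap\mathbb Z^3)$ for all integers $t\ge 1$. These polynomials exist for $P=T_\ell$ and $P=O_\ell$ and have the form $$L(T_\ell,t)=\frac{\ell^3}{3}t^3+\mu_1t^2+\mu_2t+1,\qquad L(O_\ell,t)=\frac{4\ell^3}{3}t^3+\nu_1t^2+\nu_2t+1$$ with rational coefficients. For a nonzero $v\in\mathbb Z^3$ let $\gcd(v)$ be the greatest common divisor of its coordinates, and put $$D_1=\gcd(\alpha+\beta+\gamma),\quad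 D_2=\gcd(\alpha+\beta-\gamma),\quad D_3=\gcd(\alpha-\beta+\gamma),\quad D_4=\gcd(-\alpha+\beta+\gamma).$$ Then $$\mu_1=\frac{\nu_1}{2}=\frac{\ell\,(D_1+D_2+D_3+D_4)}{4}.$$ -/

import Mathlib

open Polynomial
open scoped Pointwise

/-- The inclusion of the lattice `ℤ³` in `ℝ³`. -/
def latticeEmb (z : Fin 3 → ℤ) : Fin 3 → ℝ := fun i => (z i : ℝ)

/-- The lattice polytope with vertices in a given set of points of `ℤ³`. -/
def latticePolytope (V : Set (Fin 3 → ℤ)) : Set (Fin 3 → ℝ) :=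
  convexHull ℝ (latticeEmb '' V)

/-- The number of points of `ℤ³` in the dilate `t P`. -/
noncomputable def latticeCount (P : Set (Fin 3 → ℝ)) (t : ℕ) : ℕ :=
  {z : Fin 3 → ℤ | latticeEmb z ∈ (t : ℝ) • P}.ncard

/-- `p` is the Ehrhart polynomial of `P`: it counts the lattice points of `t P` for all
positive integers `t` (so there is at most one such `p`). -/
def IsEhrhartPolynomial (P : Set (Fin 3 → ℝ)) (p : ℚ[X]) : Prop :=
  ∀ t : ℕ, 0 < t → p.eval (t : ℚ) = (latticeCount P t : ℚ)

/-- The cubic polynomial `u t³ + v t² + w t + 1`. -/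
noncomputable def cubicWithConstOne (u v w : ℚ) : ℚ[X] :=
  C u * X ^ 3 + C v * X ^ 2 + C w * X + 1

/-- The greatest common divisor of the coordinates of an integer vector. -/
def coordGcd (v : Fin 3 → ℤ) : ℕ :=
  Nat.gcd (v 0).natAbs (Nat.gcd (v 1).natAbs (v 2).natAbs)

/-- For vectors `α, β, γ` spanning a cube with a vertex at the origin: the tetrahedron on the
origin and the three vertices of the cube that lie opposite to it in a face. -/
def tetrahedron (α β γ : Fin 3 → ℤ) : Set (Fin 3 → ℝ) :=
  latticePolytope {0, α + β, β + γ, γ + α}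

/-- The tetrahedron on the other four vertices of the cube spanned by `α, β, γ`. -/
def tetrahedron' (α β γ : Fin 3 → ℤ) : Set (Fin 3 → ℝ) :=
  latticePolytope {α, β, γ, α + β + γ}

/-- The octahedron with vertices `±α, ±β, ±γ`. -/
def octahedron (α β γ : Fin 3 → ℤ) : Set (Fin 3 → ℝ) :=
  latticePolytope {α, -α, β, -β, γ, -γ}

/-- The octahedron on the centres of the faces of the doubled cube, that is, of the cube spanned
by `2α, 2β, 2γ`. -/
def octahedron' (α β γ : Fin 3 → ℤ) : Set (Fin 3 → ℝ) :=
  latticePolytope {α + β, β + γ, γ + α, α + β + 2 • γ, β + γ + 2 • α, γ + α + 2 • β}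

/-! ### Lattice points of simplices, class by class -/

/-- The number of `m : Fin 4 → ℕ` with sum `M`. -/
noncomputable def compositionCount (M : ℤ) : ℕ :=
  Nat.card {m : Fin 4 → ℕ // ((∑ i, m i : ℕ) : ℤ) = M}

theorem finite_composition (M : ℤ) :
    Finite {m : Fin 4 → ℕ // ((∑ i, m i : ℕ) : ℤ) = M} := by
  obtain hM | hM := lt_or_ge M 0
  · have : IsEmpty {m : Fin 4 → ℕ // ((∑ i, m i : ℕ) : ℤ) = M} := ⟨fun m => by
      have := m.2
      omega⟩
    infer_instance
  · lift M to ℕ using hM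
    simp only [Nat.cast_inj]
    exact Finite.of_equiv _ (Sym.equivNatSumOfFintype (Fin 4) M)

theorem compositionCount_eq {M : ℤ} (hM : -3 ≤ M) :
    (compositionCount M : ℚ) = (M + 1) * (M + 2) * (M + 3) / 6 := by
  obtain h | h := lt_or_ge M 0
  · have : IsEmpty {m : Fin 4 → ℕ // ((∑ i, m i : ℕ) : ℤ) = M} := ⟨fun m => by
      have := m.2
      omega⟩
    rw [compositionCount, Nat.card_of_isEmpty]
    interval_cases M <;> norm_num
  · lift M to ℕ using h
    have hc : compositionCount (M : ℤ) = (M + 3).choose 3 := by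
      rw [compositionCount]
      simp only [Nat.cast_inj]
      rw [← Nat.card_congr (Sym.equivNatSumOfFintype (Fin 4) M), Nat.card_eq_fintype_card,
        Sym.card_sym_eq_choose, Fintype.card_fin,
        show 4 + M - 1 = M + 3 by omega, Nat.choose_symm_add]
    have h6 := Nat.add_one_mul_choose_eq (M + 2) 2
    have h2 := Nat.add_one_mul_choose_eq (M + 1) 1
    simp only [Nat.choose_one_right, Nat.reduceAdd, add_assoc] at h6 h2
    rw [hc]
    have h6' : ((M : ℚ) + 3) * ((M + 2).choose 2 : ℚ) = ((M + 3).choose 3 : ℚ) * 3 := by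
      exact_mod_cast h6
    have h2' : ((M : ℚ) + 2) * ((M : ℚ) + 1) = ((M + 2).choose 2 : ℚ) * 2 := by
      exact_mod_cast h2
    push_cast
    linear_combination (-1 / 3 : ℚ) * h6' - (M + 3 : ℚ) / 6 * h2'

section Classes

variable {A : Type*} [AddCommGroup A]

/-- The subgroup on which all `q i` are divisible by `N`. -/
def divLattice (q : Fin 4 → A →+ ℤ) (N : ℕ) : AddSubgroup A :=
  (AddMonoidHom.pi fun i => (Int.castAddHom (ZMod N)).comp (q i)).ker

theorem mem_divLattice {q : Fin 4 → A →+ ℤ} {N : ℕ} {z : A} :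
    z ∈ divLattice q N ↔ ∀ i, (N : ℤ) ∣ q i z := by
  simp [divLattice, AddMonoidHom.mem_ker, funext_iff, ZMod.intCast_zmod_eq_zero_iff_dvd]

instance finite_quotient_divLattice (q : Fin 4 → A →+ ℤ) (N : ℕ) [NeZero N] :
    Finite (A ⧸ divLattice q N) :=
  AddSubgroup.finite_quotient_of_finiteIndex (H := (AddMonoidHom.ker _))

noncomputable instance fintype_quotient_divLattice (q : Fin 4 → A →+ ℤ) (N : ℕ) [NeZero N] :
    Fintype (A ⧸ divLattice q N) :=
  Fintype.ofFinite _

/-- The points of the simplex cut out by the inequalities `0 ≤ q i z + c i`, sorted by their class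
and their rounded barycentric coordinates. -/
theorem card_simplex (q : Fin 4 → A →+ ℤ) (N : ℕ) [NeZero N]
    (hsum : ∀ z, ∑ i, q i z = 0) (hinj : ∀ z, (∀ i, q i z = 0) → z = 0)
    (hsurj : ∀ m : Fin 4 → ℤ, ∑ i, m i = 0 → ∃ z, ∀ i, q i z = N * m i) (c : Fin 4 → ℤ) :
    {z : A | ∀ i, 0 ≤ q i z + c i}.Finite ∧
    {z : A | ∀ i, 0 ≤ q i z + c i}.ncard =
      ∑ g : A ⧸ divLattice q N, compositionCount (∑ i, (q i g.out + c i) / (N : ℤ)) := by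
  have hN : (0 : ℤ) < N := by exact_mod_cast Nat.pos_of_ne_zero (NeZero.ne N)
  let S := {z : A // ∀ i, 0 ≤ q i z + c i}
  let R := Σ g : A ⧸ divLattice q N,
    {m : Fin 4 → ℕ // ((∑ i, m i : ℕ) : ℤ) = ∑ i, (q i g.out + c i) / (N : ℤ)}
  have hdvd : ∀ z i, ∃ d, q i z = q i (z : A ⧸ divLattice q N).out + N * d := fun z i => by
    have h : (((z : A ⧸ divLattice q N).out : A) : A ⧸ divLattice q N) = z :=
      QuotientAddGroup.out_eq' _
    rw [QuotientAddGroup.eq, mem_divLattice] at h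
    obtain ⟨d, hd⟩ := h i
    refine ⟨d, ?_⟩
    rw [map_add, map_neg] at hd
    linarith
  have hfloor : ∀ z i d, q i z = q i (z : A ⧸ divLattice q N).out + N * d →
      (q i z + c i) / (N : ℤ) = (q i (z : A ⧸ divLattice q N).out + c i) / (N : ℤ) + d :=
    fun z i d h => by
      rw [h, add_right_comm, Int.add_mul_ediv_left _ _ hN.ne']
  have hfs : ∀ z, ∑ i, (q i z + c i) / (N : ℤ) =
      ∑ i, (q i (z : A ⧸ divLattice q N).out + c i) / (N : ℤ) := fun z => by
    choose d hd using hdvd z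
    have h0 : ∑ i, d i = 0 := by
      have h1 := hsum z
      rw [Finset.sum_congr rfl fun i _ => hd i, Finset.sum_add_distrib, hsum, zero_add,
        ← Finset.mul_sum] at h1
      exact (mul_eq_zero.1 h1).resolve_left hN.ne'
    rw [Finset.sum_congr rfl fun i _ => hfloor z i _ (hd i), Finset.sum_add_distrib, h0, add_zero]
  let φ : S → R := fun z => ⟨(z.1 : A ⧸ divLattice q N),
    fun i => ((q i z.1 + c i) / (N : ℤ)).toNat, by
      rw [← hfs, Nat.cast_sum]
      exact Finset.sum_congr rfl fun i _ => Int.toNat_of_nonneg (Int.ediv_nonneg (z.2 i) hN.le)⟩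
  have hφ : Function.Bijective φ := by
    constructor
    · rintro ⟨x, hx⟩ ⟨y, hy⟩ hxy
      have h1 : (x : A ⧸ divLattice q N) = y := congrArg Sigma.fst hxy
      have h2 : ∀ i, (q i x + c i) / (N : ℤ) = (q i y + c i) / (N : ℤ) := fun i => by
        have h3 : ∀ r s : R, r = s → r.2.1 = s.2.1 := by rintro r s rfl; rfl
        have h4 := congrFun (h3 _ _ hxy) i
        have h5 := congrArg (Nat.cast : ℕ → ℤ) h4
        simpa only [φ, Int.toNat_of_nonneg (Int.ediv_nonneg (hx i) hN.le),
          Int.toNat_of_nonneg (Int.ediv_nonneg (hy i) hN.le)] using h5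
      refine Subtype.ext (sub_eq_zero.1 (hinj _ fun i => ?_))
      obtain ⟨d, hd⟩ := hdvd x i
      obtain ⟨d', hd'⟩ := hdvd y i
      have h6 := h2 i
      rw [hfloor x i d hd, hfloor y i d' hd', h1] at h6
      rw [h1] at hd
      rw [map_sub, hd, hd', add_left_cancel h6, sub_self]
    · rintro ⟨g, m, hm⟩
      obtain ⟨w, hw⟩ := hsurj (fun i => m i - (q i g.out + c i) / (N : ℤ)) (by
        rw [Finset.sum_sub_distrib, ← hm, Nat.cast_sum, sub_self])
      have hq : ∀ i, (q i (g.out + w) + c i) / (N : ℤ) = m i := fun i => by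
        rw [map_add, hw, add_right_comm, Int.add_mul_ediv_left _ _ hN.ne']
        ring
      have hg : ((g.out + w : A) : A ⧸ divLattice q N) = g := by
        conv_rhs => rw [← QuotientAddGroup.out_eq' g]
        rw [eq_comm, QuotientAddGroup.eq, mem_divLattice]
        exact fun i => ⟨_, by rw [neg_add_cancel_left]; exact hw i⟩
      refine ⟨⟨g.out + w, fun i => ?_⟩, ?_⟩
      · by_contra! hlt
        have := Int.ediv_neg_of_neg_of_pos hlt hN
        rw [hq] at this
        omega
      · have hR : ∀ r s : R, r.1 = s.1 → r.2.1 = s.2.1 → r = s := by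
          rintro ⟨r, r'⟩ ⟨s, s'⟩ (rfl : r = s) h
          exact congrArg _ (Subtype.ext h)
        exact hR _ _ hg (funext fun i => by simp only [φ, hq, Int.toNat_natCast])
  have hfin : ∀ M, Finite {m : Fin 4 → ℕ // ((∑ i, m i : ℕ) : ℤ) = M} := finite_composition
  have hS : Finite S := Finite.of_injective φ hφ.1
  refine ⟨Set.finite_coe_iff.1 hS, ?_⟩
  rw [← Nat.card_coe_set_eq]
  exact (Nat.card_congr (Equiv.ofBijective φ hφ)).trans Nat.card_sigma

/-- For a point with fractional coordinates `q i z / N`, the sum of their fractional parts. -/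
def latticeHeight (q : Fin 4 → A →+ ℤ) (N : ℕ) (z : A) : ℤ :=
  -∑ i, q i z / (N : ℤ)

theorem mul_latticeHeight (q : Fin 4 → A →+ ℤ) (N : ℕ) (hsum : ∀ z, ∑ i, q i z = 0) (z : A) :
    N * latticeHeight q N z = ∑ i, q i z % (N : ℤ) := by
  have h : ∀ i, q i z % (N : ℤ) = q i z - N * (q i z / N) := fun i => Int.emod_def _ _
  rw [Finset.sum_congr rfl fun i _ => h i, Finset.sum_sub_distrib, hsum, latticeHeight,
    ← Finset.mul_sum]
  ring

theorem latticeHeight_eq_of_coe_eq (q : Fin 4 → A →+ ℤ) (N : ℕ) [NeZero N]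
    (hsum : ∀ z, ∑ i, q i z = 0) {x y : A}
    (h : (x : A ⧸ divLattice q N) = y) : latticeHeight q N x = latticeHeight q N y := by
  have hN : (N : ℤ) ≠ 0 := by exact_mod_cast NeZero.ne N
  refine mul_left_cancel₀ hN ?_
  rw [mul_latticeHeight q N hsum, mul_latticeHeight q N hsum]
  refine Finset.sum_congr rfl fun i _ => ?_
  rw [QuotientAddGroup.eq, mem_divLattice] at h
  have := h i
  rw [map_add, map_neg, neg_add_eq_sub] at this
  exact Int.modEq_iff_dvd.2 this

theorem latticeHeight_nonneg (q : Fin 4 → A →+ ℤ) (N : ℕ) [NeZero N]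
    (hsum : ∀ z, ∑ i, q i z = 0) (z : A) : 0 ≤ latticeHeight q N z := by
  have hN : (0 : ℤ) < N := by exact_mod_cast Nat.pos_of_ne_zero (NeZero.ne N)
  refine nonneg_of_mul_nonneg_right (a := (N : ℤ)) ?_ hN
  rw [mul_latticeHeight q N hsum]
  exact Finset.sum_nonneg fun i _ => Int.emod_nonneg _ hN.ne'

theorem latticeHeight_add_le (q : Fin 4 → A →+ ℤ) (N : ℕ) [NeZero N]
    (hsum : ∀ z, ∑ i, q i z = 0) (z : A) (i : Fin 4) :
    latticeHeight q N z + (if (N : ℤ) ∣ q i z then 1 else 0) ≤ 3 := by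
  have hN : (0 : ℤ) < N := by exact_mod_cast Nat.pos_of_ne_zero (NeZero.ne N)
  have h := mul_latticeHeight q N hsum z
  rw [← Finset.add_sum_erase _ _ (Finset.mem_univ i)] at h
  have h3 : ∑ j ∈ Finset.univ.erase i, q j z % (N : ℤ) ≤ ∑ j ∈ Finset.univ.erase i, ((N : ℤ) - 1) :=
    Finset.sum_le_sum fun j _ => Int.le_sub_one_of_lt (Int.emod_lt_of_pos _ hN)
  rw [Finset.sum_const, Finset.card_erase_of_mem (Finset.mem_univ i), Finset.card_univ,
    Fintype.card_fin, nsmul_eq_mul] at h3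
  push_cast at h3
  split_ifs with hd
  · rw [Int.emod_eq_zero_of_dvd hd] at h
    nlinarith
  · have := Int.emod_lt_of_pos (q i z) hN
    nlinarith

theorem dvd_of_latticeHeight_eq_zero (q : Fin 4 → A →+ ℤ) (N : ℕ) [NeZero N]
    (hsum : ∀ z, ∑ i, q i z = 0) {z : A} (hz : latticeHeight q N z = 0) (i : Fin 4) :
    (N : ℤ) ∣ q i z := by
  have hN : (0 : ℤ) < N := by exact_mod_cast Nat.pos_of_ne_zero (NeZero.ne N)
  have h := mul_latticeHeight q N hsum z
  rw [hz, mul_zero, eq_comm, Finset.sum_eq_zero_iff_of_nonneg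
    fun i _ => Int.emod_nonneg _ hN.ne'] at h
  exact Int.dvd_of_emod_eq_zero (h i (Finset.mem_univ i))

theorem latticeHeight_add_neg (q : Fin 4 → A →+ ℤ) (N : ℕ) [NeZero N] (z : A) :
    latticeHeight q N z + latticeHeight q N (-z) =
      4 - ∑ i, (if (N : ℤ) ∣ q i z then 1 else 0) := by
  have hN : (0 : ℤ) < N := by exact_mod_cast Nat.pos_of_ne_zero (NeZero.ne N)
  have h : ∀ i, q i z / (N : ℤ) + q i (-z) / (N : ℤ) = (if (N : ℤ) ∣ q i z then 1 else 0) - 1 :=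
    fun i => by
      rw [map_neg]
      split_ifs with hd
      · rw [Int.neg_ediv_of_dvd hd]
        ring
      · rw [Int.neg_ediv, if_neg hd, Int.sign_eq_one_of_pos hN]
        ring
  have h4 := Finset.sum_congr (rfl : (Finset.univ : Finset (Fin 4)) = _) fun i _ => h i
  rw [Finset.sum_add_distrib, Finset.sum_sub_distrib] at h4
  rw [latticeHeight, latticeHeight]
  simp only [Finset.sum_const, Finset.card_univ, Fintype.card_fin] at h4
  norm_num at h4 ⊢
  linarith

end Classes

section Sums

theorem sum_compositionCount {G : Type*} [Fintype G] (κ : G → ℤ) (h0 : ∀ g, 0 ≤ κ g)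
    (h3 : ∀ g, κ g ≤ 3) :
    ∃ w : ℚ, ∀ t : ℕ, ((∑ g, compositionCount (t - κ g) : ℕ) : ℚ) =
      (Fintype.card G : ℚ) / 6 * t ^ 3 + (∑ g, (1 - (κ g : ℚ) / 2)) * t ^ 2 + w * t +
        ∑ g, (if κ g = 0 then (1 : ℚ) else 0) := by
  refine ⟨∑ g, (3 * (κ g : ℚ) ^ 2 - 12 * κ g + 11) / 6, fun t => ?_⟩
  have h : ∀ g, (compositionCount (t - κ g) : ℚ) = 1 / 6 * (t : ℚ) ^ 3 +
      (1 - (κ g : ℚ) / 2) * t ^ 2 + (3 * (κ g : ℚ) ^ 2 - 12 * κ g + 11) / 6 * t +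
      (if κ g = 0 then (1 : ℚ) else 0) := fun g => by
    have hk0 := h0 g
    have hk3 := h3 g
    rw [compositionCount_eq (by omega)]
    have hc : (if κ g = 0 then (1 : ℚ) else 0) =
        (1 - (κ g : ℚ)) * (2 - (κ g : ℚ)) * (3 - (κ g : ℚ)) / 6 := by
      generalize κ g = k at *
      interval_cases k <;> norm_num
    rw [hc]
    push_cast
    ring
  rw [Nat.cast_sum, Finset.sum_congr rfl fun g _ => h g, Finset.sum_add_distrib,
    Finset.sum_add_distrib, Finset.sum_add_distrib, ← Finset.sum_mul, ← Finset.sum_mul,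
    ← Finset.sum_mul, Finset.sum_const, Finset.card_univ, nsmul_eq_mul, mul_one_div]

variable {A : Type*} [AddCommGroup A]

theorem mk_out_neg (q : Fin 4 → A →+ ℤ) (N : ℕ) (g : A ⧸ divLattice q N) :
    (((-g).out : A) : A ⧸ divLattice q N) = ((-g.out : A) : A ⧸ divLattice q N) := by
  rw [QuotientAddGroup.out_eq', QuotientAddGroup.mk_neg, QuotientAddGroup.out_eq']

theorem mk_eq_zero_of_dvd {q : Fin 4 → A →+ ℤ} {N : ℕ} {g : A ⧸ divLattice q N} (h : ∀ i, (N : ℤ) ∣ q i g.out) : g = 0 := by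
  rw [← QuotientAddGroup.out_eq' g]
  exact (QuotientAddGroup.eq_zero_iff _).2 (mem_divLattice.2 h)

variable (q : Fin 4 → A →+ ℤ) (N : ℕ) [NeZero N]

/-- The number of classes modulo `divLattice q N` on which `q i` is divisible by `N`. -/
noncomputable def facetClassCount (i : Fin 4) : ℕ :=
  ∑ g : A ⧸ divLattice q N, if (N : ℤ) ∣ q i g.out then 1 else 0

theorem sum_latticeHeight (hsum : ∀ z, ∑ i, q i z = 0) :
    ∑ g : A ⧸ divLattice q N, (1 - (latticeHeight q N g.out : ℚ) / 2) =
      (∑ i, (facetClassCount q N i : ℚ)) / 4 := by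
  have h1 : ∑ g : A ⧸ divLattice q N, latticeHeight q N (-g.out) =
      ∑ g : A ⧸ divLattice q N, latticeHeight q N g.out := by
    rw [← Equiv.sum_comp (Equiv.neg (A ⧸ divLattice q N)) fun g => latticeHeight q N g.out]
    exact Finset.sum_congr rfl fun g _ =>
      (latticeHeight_eq_of_coe_eq q N hsum (mk_out_neg q N g)).symm
  have h2 := Finset.sum_congr (rfl : (Finset.univ : Finset (A ⧸ divLattice q N)) = _)
    fun g _ => latticeHeight_add_neg q N g.out
  rw [Finset.sum_add_distrib, h1, Finset.sum_sub_distrib, Finset.sum_comm] at h2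
  have h3 : (2 * ∑ g : A ⧸ divLattice q N, (latticeHeight q N g.out : ℚ)) =
      ∑ _g : A ⧸ divLattice q N, (4 : ℚ) - ∑ i, (facetClassCount q N i : ℚ) := by
    rw [two_mul]
    simp only [facetClassCount]
    exact_mod_cast h2
  rw [Finset.sum_sub_distrib, ← Finset.sum_div]
  simp only [Finset.sum_const, nsmul_eq_mul] at h3 ⊢
  linarith

theorem latticeHeight_out_zero (hsum : ∀ z, ∑ i, q i z = 0) :
    latticeHeight q N (0 : A ⧸ divLattice q N).out = 0 := by
  rw [latticeHeight_eq_of_coe_eq q N hsum (y := 0)]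
  · simp [latticeHeight]
  · rw [QuotientAddGroup.out_eq']
    rfl

theorem sum_latticeHeight_eq_zero (hsum : ∀ z, ∑ i, q i z = 0) :
    ∑ g : A ⧸ divLattice q N, (if latticeHeight q N g.out = 0 then (1 : ℚ) else 0) = 1 := by
  rw [Finset.sum_eq_single 0]
  · rw [if_pos (latticeHeight_out_zero q N hsum)]
  · exact fun g _ hg => if_neg fun h =>
      hg (mk_eq_zero_of_dvd fun i => dvd_of_latticeHeight_eq_zero q N hsum h i)
  · exact fun h => (h (Finset.mem_univ _)).elim

end Sums

section Frames

variable {A : Type*} [AddCommGroup A]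

/-- The forms `q i` are barycentric coordinates on `A`, up to scaling, for a simplex with vertices
in `A` on which they take values divisible by `N`. -/
structure IsSimplexFrame (q : Fin 4 → A →+ ℤ) (N : ℕ) : Prop where
  sum_eq_zero : ∀ z, ∑ i, q i z = 0
  eq_zero : ∀ z, (∀ i, q i z = 0) → z = 0
  exists_eq : ∀ m : Fin 4 → ℤ, ∑ i, m i = 0 → ∃ z, ∀ i, q i z = N * m i

variable {q : Fin 4 → A →+ ℤ} {N : ℕ} [NeZero N]

theorem IsSimplexFrame.ncard_simplex (hq : IsSimplexFrame q N) (d : Fin 4 → ℤ) :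
    {z : A | ∀ i, 0 ≤ q i z + N * d i}.ncard =
      ∑ g : A ⧸ divLattice q N, compositionCount (∑ i, d i - latticeHeight q N g.out) := by
  have hN : (N : ℤ) ≠ 0 := by exact_mod_cast NeZero.ne N
  rw [(card_simplex q N hq.1 hq.2 hq.3 fun i => N * d i).2]
  refine Finset.sum_congr rfl fun g _ => congrArg _ ?_
  simp only [Int.add_mul_ediv_left _ _ hN, Finset.sum_add_distrib, latticeHeight]
  ring

theorem Int.sub_one_ediv_of_pos {a N : ℤ} (hN : 0 < N) :
    (a - 1) / N = a / N - if N ∣ a then 1 else 0 := by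
  have ha := Int.emod_add_mul_ediv a N
  have h0 := Int.emod_nonneg a hN.ne'
  have h1 := Int.emod_lt_of_pos a hN
  split_ifs with hd
  · rw [Int.emod_eq_zero_of_dvd hd] at ha
    rw [Int.ediv_eq_iff_of_pos hN]
    constructor <;> nlinarith
  · have : a % N ≠ 0 := fun h => hd (Int.dvd_of_emod_eq_zero h)
    rw [Int.ediv_eq_iff_of_pos hN]
    constructor <;> nlinarith [h0.lt_of_ne' this]

/-- The count of `ncard_simplex` for the simplex without its `i`-th facet. -/
theorem IsSimplexFrame.ncard_simplex_diff_facet (hq : IsSimplexFrame q N) (d : Fin 4 → ℤ)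
    (i : Fin 4) :
    {z : A | ∀ j, 0 ≤ q j z + (N * d j - if j = i then 1 else 0)}.ncard =
      ∑ g : A ⧸ divLattice q N, compositionCount (∑ i, d i -
        (latticeHeight q N g.out + if (N : ℤ) ∣ q i g.out then 1 else 0)) := by
  have hN : (0 : ℤ) < N := by exact_mod_cast Nat.pos_of_ne_zero (NeZero.ne N)
  rw [(card_simplex q N hq.1 hq.2 hq.3 fun j => N * d j - if j = i then 1 else 0).2]
  refine Finset.sum_congr rfl fun g _ => congrArg _ ?_
  have h : ∀ j, (q j g.out + (N * d j - if j = i then 1 else 0)) / (N : ℤ) =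
      q j g.out / N + d j - if j = i then (if (N : ℤ) ∣ q i g.out then 1 else 0) else 0 := by
    intro j
    rw [show q j g.out + (N * d j - if j = i then (1 : ℤ) else 0) =
      (q j g.out - if j = i then 1 else 0) + N * d j by ring, Int.add_mul_ediv_left _ _ hN.ne']
    split_ifs with hj hd
    · rw [hj, Int.sub_one_ediv_of_pos hN, if_pos hd]
      ring
    · rw [hj, Int.sub_one_ediv_of_pos hN, if_neg hd]
      ring
    all_goals simp
  rw [Finset.sum_congr rfl fun j _ => h j, Finset.sum_sub_distrib, Finset.sum_add_distrib,
    Finset.sum_ite_eq' Finset.univ i, if_pos (Finset.mem_univ i), latticeHeight]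
  ring

/-- The Ehrhart polynomial of a simplex. -/
theorem IsSimplexFrame.exists_ncard_simplex (hq : IsSimplexFrame q N) :
    ∃ w : ℚ, ∀ (t : ℕ) (d : Fin 4 → ℤ), ∑ i, d i = t →
      ({z : A | ∀ i, 0 ≤ q i z + N * d i}.ncard : ℚ) =
        (Nat.card (A ⧸ divLattice q N) : ℚ) / 6 * t ^ 3 +
          (∑ i, (facetClassCount q N i : ℚ)) / 4 * t ^ 2 + w * t + 1 := by
  obtain ⟨w, hw⟩ := sum_compositionCount (fun g : A ⧸ divLattice q N => latticeHeight q N g.out)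
    (fun g => latticeHeight_nonneg q N hq.1 _) fun g => by
      have := latticeHeight_add_le q N hq.1 g.out 0
      split_ifs at this <;> omega
  refine ⟨w, fun t d hd => ?_⟩
  rw [hq.ncard_simplex, hd, hw, sum_latticeHeight q N hq.1, sum_latticeHeight_eq_zero q N hq.1,
    Nat.card_eq_fintype_card]

theorem IsSimplexFrame.exists_ncard_simplex_diff_facet (hq : IsSimplexFrame q N) (i : Fin 4) :
    ∃ w : ℚ, ∀ (t : ℕ) (d : Fin 4 → ℤ), ∑ i, d i = t →
      ({z : A | ∀ j, 0 ≤ q j z + (N * d j - if j = i then 1 else 0)}.ncard : ℚ) =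
        (Nat.card (A ⧸ divLattice q N) : ℚ) / 6 * t ^ 3 +
          ((∑ i, (facetClassCount q N i : ℚ)) / 4 - facetClassCount q N i / 2) * t ^ 2 + w * t := by
  obtain ⟨w, hw⟩ := sum_compositionCount (fun g : A ⧸ divLattice q N =>
      latticeHeight q N g.out + if (N : ℤ) ∣ q i g.out then 1 else 0)
    (fun g => by
      have h0 := latticeHeight_nonneg q N hq.1 g.out
      split_ifs <;> omega)
    fun g => latticeHeight_add_le q N hq.1 g.out i
  refine ⟨w, fun t d hd => ?_⟩
  have h0 : ∀ g : A ⧸ divLattice q N,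
      (latticeHeight q N g.out + if (N : ℤ) ∣ q i g.out then 1 else 0) ≠ 0 := fun g h => by
    have h0 := latticeHeight_nonneg q N hq.1 g.out
    split_ifs at h with hd
    · omega
    · exact hd (dvd_of_latticeHeight_eq_zero q N hq.1 (by omega) i)
  have h1 : ∑ g : A ⧸ divLattice q N, (1 - ((latticeHeight q N g.out +
      if (N : ℤ) ∣ q i g.out then 1 else 0 : ℤ) : ℚ) / 2) =
      (∑ i, (facetClassCount q N i : ℚ)) / 4 - facetClassCount q N i / 2 := by
    rw [← sum_latticeHeight q N hq.1, facetClassCount, Nat.cast_sum, Finset.sum_div,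
      ← Finset.sum_sub_distrib]
    refine Finset.sum_congr rfl fun g _ => ?_
    push_cast
    ring
  rw [hq.ncard_simplex_diff_facet, hd, hw, h1, Finset.sum_eq_zero fun g _ => if_neg (h0 g),
    Nat.card_eq_fintype_card, add_zero]

theorem ncard_translate (q : Fin 4 → A →+ ℤ) (c : Fin 4 → ℤ) (v : A) :
    {z : A | ∀ i, 0 ≤ q i z + c i}.ncard = {z : A | ∀ i, 0 ≤ q i z + (c i + q i v)}.ncard := by
  rw [← Set.ncard_image_of_injective _ (sub_left_injective (b := v))]
  congr 1
  ext z
  simp only [Set.mem_image, Set.mem_ofPred_eq]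
  constructor
  · rintro ⟨y, hy, rfl⟩ i
    have := hy i
    rw [map_sub]
    linarith
  · intro h
    refine ⟨z + v, fun i => ?_, add_sub_cancel_right _ _⟩
    have := h i
    rw [map_add]
    linarith

/-- A simplex is made up of an octahedron and of four corners. -/
theorem IsSimplexFrame.ncard_octahedron (hq : IsSimplexFrame q N) (m : ℤ) :
    {z : A | ∀ i, 0 ≤ q i z + m}.ncard = {z : A | ∀ i, |q i z| ≤ m}.ncard +
      ∑ i, {z : A | ∀ j, 0 ≤ q j z + if j = i then -m - 1 else m}.ncard := by
  have hcorner : ∀ i, {z : A | ∀ j, 0 ≤ q j z + if j = i then -m - 1 else m}.Finite := fun i =>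
    (card_simplex q N hq.1 hq.2 hq.3 _).1
  have hoct : {z : A | ∀ i, |q i z| ≤ m}.Finite :=
    (card_simplex q N hq.1 hq.2 hq.3 fun _ => m).1.subset fun z hz i => by
      have := (abs_le.1 (hz i)).1
      linarith
  have hU : {z : A | ∀ i, 0 ≤ q i z + m} = {z : A | ∀ i, |q i z| ≤ m} ∪
      ⋃ i, {z : A | ∀ j, 0 ≤ q j z + if j = i then -m - 1 else m} := by
    ext z
    have h4 := hq.sum_eq_zero z
    simp only [Fin.sum_univ_four] at h4
    simp only [Set.mem_union, Set.mem_iUnion, Set.mem_ofPred_eq, Fin.forall_fin_succ,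
      Fin.exists_fin_succ, abs_le]
    simp
    omega
  rw [hU, Set.ncard_union_eq ?_ hoct (Set.finite_iUnion hcorner)]
  · rw [Set.ncard_iUnion_of_finite hcorner, finsum_eq_sum_of_fintype]
    intro i j hij
    rw [Function.onFun, Set.disjoint_left]
    intro z hi hj
    have h4 := hq.sum_eq_zero z
    simp only [Fin.sum_univ_four] at h4
    simp only [Set.mem_ofPred_eq, Fin.forall_fin_succ] at hi hj
    fin_cases i <;> fin_cases j <;> simp at hij hi hj <;> omega
  · rw [Set.disjoint_iUnion_right]
    intro i
    rw [Set.disjoint_left]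
    intro z hz hi
    have h1 := (abs_le.1 (hz i)).2
    have h2 := hi i
    rw [if_pos rfl] at h2
    omega

/-- The Ehrhart polynomial of an octahedron. -/
theorem IsSimplexFrame.exists_ncard_octahedron (hq : IsSimplexFrame q N) {m : ℕ} (hm : N = 2 * m)
    {v : A} (hv : ∀ i, q i v = if i = 0 then -3 * (m : ℤ) else m) :
    ∃ w : ℚ, ∀ t : ℕ, ({z : A | ∀ i, |q i z| ≤ (m * t : ℤ)}.ncard : ℚ) =
      2 * (Nat.card (A ⧸ divLattice q N) : ℚ) / 3 * t ^ 3 +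
        (∑ i, (facetClassCount q N i : ℚ)) / 2 * t ^ 2 + w * t + 1 := by
  obtain ⟨w, hw⟩ := hq.exists_ncard_simplex
  choose u hu using hq.exists_ncard_simplex_diff_facet
  refine ⟨2 * w - ∑ i, u i, fun t => ?_⟩
  have h1 : {z : A | ∀ i, 0 ≤ q i z + (m * t : ℤ)}.ncard =
      {z : A | ∀ i, 0 ≤ q i z + N * (if i = 0 then 2 * (t : ℤ) else 0)}.ncard := by
    rw [ncard_translate q _ (-(t : ℤ) • v)]
    congr! 6 with z i
    rw [map_zsmul, hv, hm]
    split_ifs <;> push_cast <;> simp <;> ring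
  have h2 : ∀ i, {z : A | ∀ j, 0 ≤ q j z + if j = i then -(m * t : ℤ) - 1 else (m * t : ℤ)}.ncard =
      {z : A | ∀ j, 0 ≤ q j z + (N * ((if j = 0 then 2 * (t : ℤ) else 0) - if j = i then (t : ℤ) else 0) -
        if j = i then 1 else 0)}.ncard := fun i => by
    rw [ncard_translate q _ (-(t : ℤ) • v)]
    congr! 6 with z j
    rw [map_zsmul, hv, hm]
    split_ifs <;> push_cast <;> simp <;> ring
  have h3 := congrArg (Nat.cast : ℕ → ℚ) (hq.ncard_octahedron (m * t))
  rw [Nat.cast_add, Nat.cast_sum, h1, hw (2 * t) _ (by simp)] at h3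
  have h4 := fun i => (congrArg (Nat.cast : ℕ → ℚ) (h2 i)).trans (hu i t _ (by
    simp [Finset.sum_sub_distrib]
    ring))
  rw [Finset.sum_congr rfl fun i _ => h4 i] at h3
  simp only [Fin.sum_univ_four] at h3 ⊢
  push_cast at h3
  linear_combination -h3

end Frames

section Index

theorem facetClassCount_mul {A : Type*} [AddCommGroup A] (q : Fin 4 → A →+ ℤ) (N : ℕ) [NeZero N]
    (i : Fin 4) {D : ℕ} (hD : ∀ z, (D : ℤ) ∣ q i z) (hx : ∃ z, q i z = D) (hDN : D ∣ N) :
    facetClassCount q N i * N = Nat.card (A ⧸ divLattice q N) * D := by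
  let f : A →+ ZMod N := (Int.castAddHom (ZMod N)).comp (q i)
  have hf : ∀ z, f z = ((q i z : ℤ) : ZMod N) := fun _ => rfl
  let ψ : A ⧸ divLattice q N →+ ZMod N := QuotientAddGroup.lift _ f fun z hz => by
    rw [AddMonoidHom.mem_ker, hf, ZMod.intCast_zmod_eq_zero_iff_dvd]
    exact mem_divLattice.1 hz i
  have hψ : ∀ g, ψ g = ((q i g.out : ℤ) : ZMod N) := fun g => by
    conv_lhs => rw [← QuotientAddGroup.out_eq' g]
    rfl
  have hker : Nat.card ψ.ker = facetClassCount q N i := by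
    rw [facetClassCount, Finset.sum_boole, Nat.cast_id, ← Fintype.card_subtype,
      ← Nat.card_eq_fintype_card]
    exact Nat.card_congr (Equiv.subtypeEquivRight fun g => by
      rw [AddMonoidHom.mem_ker, hψ, ZMod.intCast_zmod_eq_zero_iff_dvd])
  have hrange : Nat.card ψ.range = N / D := by
    have : ψ.range = AddSubgroup.zmultiples ((D : ℕ) : ZMod N) := by
      apply le_antisymm
      · rintro _ ⟨g, rfl⟩
        obtain ⟨k, hk⟩ := hD g.out
        rw [hψ, hk]
        exact ⟨k, by simp [mul_comm]⟩
      · rw [AddSubgroup.zmultiples_le]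
        obtain ⟨z, hz⟩ := hx
        exact ⟨(z : A ⧸ divLattice q N), by
          change ((q i z : ℤ) : ZMod N) = _
          rw [hz, Int.cast_natCast]⟩
    rw [this, Nat.card_zmultiples, ZMod.addOrderOf_coe _ (NeZero.ne N), Nat.gcd_eq_right hDN]
  have h := ψ.ker.card_mul_index
  rw [AddSubgroup.index_ker, hker, hrange] at h
  rw [← h, mul_assoc, Nat.div_mul_cancel hDN]

theorem card_quotient_divLattice (q : Fin 4 → (Fin 3 → ℤ) →+ ℤ) (N : ℕ) [NeZero N]
    (hq : IsSimplexFrame q N) (a : Fin 3 → Fin 3 → ℤ)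
    (ha : ∀ i j, q (Fin.succ i) (a j) = if i = j then (N : ℤ) else 0) :
    Nat.card ((Fin 3 → ℤ) ⧸ divLattice q N) = (Matrix.of a).det.natAbs := by
  have hN : (N : ℤ) ≠ 0 := by exact_mod_cast NeZero.ne N
  have hsucc : ∀ z, (∀ i : Fin 3, q i.succ z = 0) → z = 0 := fun z h => by
    refine hq.eq_zero z (Fin.cases ?_ h)
    have := hq.sum_eq_zero z
    rwa [Fin.sum_univ_succ, Finset.sum_eq_zero fun i _ => h i, add_zero] at this
  have hmem : ∀ j, a j ∈ divLattice q N := fun j => by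
    rw [mem_divLattice]
    have h : ∀ i : Fin 3, (N : ℤ) ∣ q i.succ (a j) := fun i => by
      rw [ha]
      split_ifs <;> simp
    refine Fin.cases ?_ h
    have := hq.sum_eq_zero (a j)
    rw [Fin.sum_univ_succ] at this
    rw [eq_neg_of_add_eq_zero_left this]
    exact (Finset.dvd_sum fun i _ => h i).neg_right
  let v : Fin 3 → divLattice q N := fun j => ⟨a j, hmem j⟩
  let f : (Fin 3 → ℤ) →ₗ[ℤ] divLattice q N := Fintype.linearCombination ℤ v
  have hf : ∀ x (i : Fin 3), q i.succ (f x : Fin 3 → ℤ) = x i * N := fun x i => by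
    simp only [f, Fintype.linearCombination_apply, v, AddSubgroup.val_finsetSum,
      AddSubgroup.coe_zsmul, map_sum, map_zsmul, ha, smul_eq_mul]
    simp
  have hbij : Function.Bijective f := by
    constructor
    · rw [injective_iff_map_eq_zero]
      intro x hx
      funext i
      have := hf x i
      rw [hx, ZeroMemClass.coe_zero, map_zero, eq_comm] at this
      exact (mul_eq_zero.1 this).resolve_right hN
    · rintro ⟨z, hz⟩
      choose d hd using fun i : Fin 3 => mem_divLattice.1 hz i.succ
      refine ⟨d, Subtype.ext (sub_eq_zero.1 (hsucc _ fun i => ?_))⟩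
      rw [map_sub, hf, hd, mul_comm, sub_self]
  let b : Module.Basis (Fin 3) ℤ (divLattice q N) :=
    Module.Basis.ofEquivFun (LinearEquiv.ofBijective f hbij).symm
  have hb : ∀ j, (b j : Fin 3 → ℤ) = a j := fun j => by
    simp [b, f, v, Fintype.linearCombination_apply_single]
  have h := AddSubgroup.index_eq_natAbs_det (Pi.basisFun ℤ (Fin 3)) (divLattice q N) b
  rw [Pi.basisFun_det] at h
  simp only [hb] at h
  exact h

theorem coordGcd_dvd_dotProduct (v z : Fin 3 → ℤ) : (coordGcd v : ℤ) ∣ v ⬝ᵥ z := by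
  have h0 : coordGcd v ∣ (v 0).natAbs := Nat.gcd_dvd_left _ _
  have h1 : coordGcd v ∣ (v 1).natAbs := (Nat.gcd_dvd_right _ _).trans (Nat.gcd_dvd_left _ _)
  have h2 : coordGcd v ∣ (v 2).natAbs := (Nat.gcd_dvd_right _ _).trans (Nat.gcd_dvd_right _ _)
  rw [← Int.natCast_dvd] at h0 h1 h2
  simp only [dotProduct, Fin.sum_univ_three]
  exact ((h0.mul_right _).add (h1.mul_right _)).add (h2.mul_right _)

theorem exists_dotProduct_eq_coordGcd (v : Fin 3 → ℤ) : ∃ z, v ⬝ᵥ z = coordGcd v := by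
  have h1 := Int.gcd_eq_gcd_ab (v 1) (v 2)
  have h2 := Int.gcd_eq_gcd_ab (v 0) (Int.gcd (v 1) (v 2))
  have h3 : coordGcd v = Int.gcd (v 0) (Int.gcd (v 1) (v 2)) := by
    simp [coordGcd, Int.gcd]
  refine ⟨![Int.gcdA (v 0) (Int.gcd (v 1) (v 2)),
    Int.gcdA (v 1) (v 2) * Int.gcdB (v 0) (Int.gcd (v 1) (v 2)),
    Int.gcdB (v 1) (v 2) * Int.gcdB (v 0) (Int.gcd (v 1) (v 2))], ?_⟩
  rw [h3, h2]
  simp only [dotProduct, Fin.sum_univ_three]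
  simp
  linear_combination (-Int.gcdB (v 0) (Int.gcd (v 1) (v 2))) * h1

theorem coordGcd_neg (v : Fin 3 → ℤ) : coordGcd (-v) = coordGcd v := by
  simp [coordGcd]

end Index

section Hull

theorem latticeEmb_add (x y : Fin 3 → ℤ) : latticeEmb (x + y) = latticeEmb x + latticeEmb y := by
  ext; simp [latticeEmb]

theorem latticeEmb_smul (n : ℤ) (x : Fin 3 → ℤ) : latticeEmb (n • x) = (n : ℝ) • latticeEmb x := by
  ext; simp [latticeEmb]

theorem dotProduct_latticeEmb (x y : Fin 3 → ℤ) :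
    latticeEmb x ⬝ᵥ latticeEmb y = ((x ⬝ᵥ y : ℤ) : ℝ) := by
  simp [latticeEmb, dotProduct]

theorem sum_smul_mem_latticePolytope {V : Set (Fin 3 → ℤ)} {ι : Type*} [Fintype ι]
    (p : ι → Fin 3 → ℤ) (hp : ∀ i, p i ∈ V) (w : ι → ℝ) (h0 : ∀ i, 0 ≤ w i) (h1 : ∑ i, w i = 1) :
    ∑ i, w i • latticeEmb (p i) ∈ latticePolytope V :=
  (convex_convexHull ℝ _).sum_mem (fun i _ => h0 i) h1 fun i _ =>
    subset_convexHull ℝ _ ⟨p i, hp i, rfl⟩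

theorem dotProduct_le_of_mem_latticePolytope {V : Set (Fin 3 → ℤ)} {v : Fin 3 → ℤ} {c : ℤ}
    (h : ∀ x ∈ V, v ⬝ᵥ x ≤ c) {y : Fin 3 → ℝ} (hy : y ∈ latticePolytope V) :
    latticeEmb v ⬝ᵥ y ≤ c := by
  refine convexHull_min (t := {y | latticeEmb v ⬝ᵥ y ≤ c}) ?_ ?_ hy
  · rintro _ ⟨x, hx, rfl⟩
    rw [Set.mem_ofPred_eq, dotProduct_latticeEmb]
    exact_mod_cast h x hx
  · exact convex_halfSpace_le
      ⟨fun x y => dotProduct_add _ x y, fun r x => dotProduct_smul r _ x⟩ _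

/-- Point reflections and translations of the lattice preserve the number of lattice points. -/
theorem latticeCount_image (V : Set (Fin 3 → ℤ)) (v : Fin 3 → ℤ) {ε : ℤ} (hε : ε * ε = 1) (t : ℕ) :
    latticeCount (latticePolytope ((fun z => v + ε • z) '' V)) t =
      latticeCount (latticePolytope V) t := by
  have hεr : (ε : ℝ) * ε = 1 := by exact_mod_cast hε
  have hP : latticePolytope ((fun z => v + ε • z) '' V) =
      latticeEmb v +ᵥ (ε : ℝ) • latticePolytope V := by
    rw [latticePolytope, latticePolytope, ← convexHull_smul, ← convexHull_vadd]
    congr 1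
    ext x
    simp only [Set.mem_image, Set.mem_vadd_set, Set.mem_smul_set, exists_exists_and_eq_and,
      latticeEmb_add, latticeEmb_smul, vadd_eq_add]
  have hinj : Function.Injective fun z : Fin 3 → ℤ => t • v + ε • z := fun x y h => by
    have := congrArg (fun z => ε • z) (add_left_cancel h)
    simpa only [smul_smul, hε, one_smul] using this
  rw [latticeCount, latticeCount, hP,
    ← Set.ncard_image_of_injective {z | latticeEmb z ∈ (t : ℝ) • latticePolytope V} hinj]
  congr 1
  have hv : (t : ℝ) • latticeEmb v = latticeEmb (t • v) := by
    ext; simp [latticeEmb]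
  ext z
  simp only [Set.mem_image, Set.mem_ofPred_eq, Set.mem_vadd_set, Set.mem_smul_set, vadd_eq_add]
  constructor
  · rintro ⟨_, ⟨_, ⟨x, hx, rfl⟩, rfl⟩, hz⟩
    refine ⟨ε • (z - t • v), ⟨x, hx, ?_⟩, by
      simp only [smul_smul, hε, one_smul, add_sub_cancel]⟩
    have h2 : latticeEmb (z - t • v) = latticeEmb z - (t : ℝ) • latticeEmb v := by
      rw [hv]; ext; simp [latticeEmb]
    rw [latticeEmb_smul, h2, ← hz, smul_add, add_sub_cancel_left, smul_comm, smul_smul, smul_smul,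
      mul_assoc, hεr, mul_one]
  · rintro ⟨y, ⟨x, hx, hy⟩, rfl⟩
    refine ⟨_, ⟨_, ⟨x, hx, rfl⟩, rfl⟩, ?_⟩
    rw [latticeEmb_add, latticeEmb_smul, ← hy, smul_add, hv, smul_comm]

end Hull

/-- `α, β, γ` are the edges at a vertex of a lattice cube with edges of length `ℓ`. -/
structure IsCubeFrame (α β γ : Fin 3 → ℤ) (ℓ : ℕ) : Prop where
  pos : 0 < ℓ
  αα : α ⬝ᵥ α = (ℓ : ℤ) ^ 2
  ββ : β ⬝ᵥ β = (ℓ : ℤ) ^ 2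
  γγ : γ ⬝ᵥ γ = (ℓ : ℤ) ^ 2
  αβ : α ⬝ᵥ β = 0
  αγ : α ⬝ᵥ γ = 0
  βγ : β ⬝ᵥ γ = 0

/-- The normals of the facets of the inscribed tetrahedron. -/
def facetNormal (α β γ : Fin 3 → ℤ) : Fin 4 → Fin 3 → ℤ :=
  ![-(α + β + γ), α + β - γ, α - β + γ, -α + β + γ]

/-- The linear forms belonging to `facetNormal`. -/
def facetForm (α β γ : Fin 3 → ℤ) (i : Fin 4) : (Fin 3 → ℤ) →+ ℤ where
  toFun z := facetNormal α β γ i ⬝ᵥ z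
  map_zero' := dotProduct_zero _
  map_add' := dotProduct_add _

namespace IsCubeFrame

variable {α β γ : Fin 3 → ℤ} {ℓ : ℕ}

theorem facetForm_apply (α β γ z : Fin 3 → ℤ) (i : Fin 4) : facetForm α β γ i z =
    ![-(α ⬝ᵥ z + β ⬝ᵥ z + γ ⬝ᵥ z), α ⬝ᵥ z + β ⬝ᵥ z - γ ⬝ᵥ z, α ⬝ᵥ z - β ⬝ᵥ z + γ ⬝ᵥ z,
      -(α ⬝ᵥ z) + β ⬝ᵥ z + γ ⬝ᵥ z] i := by
  change facetNormal α β γ i ⬝ᵥ z = _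
  fin_cases i <;>
    simp [facetNormal, add_dotProduct, sub_dotProduct, neg_dotProduct]

theorem βα (h : IsCubeFrame α β γ ℓ) : β ⬝ᵥ α = 0 := by rw [dotProduct_comm, h.αβ]

theorem γα (h : IsCubeFrame α β γ ℓ) : γ ⬝ᵥ α = 0 := by rw [dotProduct_comm, h.αγ]

theorem γβ (h : IsCubeFrame α β γ ℓ) : γ ⬝ᵥ β = 0 := by rw [dotProduct_comm, h.βγ]

theorem matrix_mul_transpose (h : IsCubeFrame α β γ ℓ) :
    Matrix.of ![α, β, γ] * (Matrix.of ![α, β, γ]).transpose = (ℓ : ℤ) ^ 2 • (1 : Matrix (Fin 3) (Fin 3) ℤ) := by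
  have h1 : ∀ i j, (Matrix.of ![α, β, γ] * (Matrix.of ![α, β, γ]).transpose) i j =
    ![α, β, γ] i ⬝ᵥ ![α, β, γ] j := fun i j => rfl
  ext i j
  rw [h1]
  fin_cases i <;> fin_cases j <;>
    simp [h.αα, h.ββ, h.γγ, h.αβ, h.αγ, h.βγ, h.βα, h.γα, h.γβ]

theorem transpose_mul_matrix (h : IsCubeFrame α β γ ℓ) (i j : Fin 3) :
    α i * α j + β i * β j + γ i * γ j = if i = j then (ℓ : ℤ) ^ 2 else 0 := by
  have hl : (ℓ : ℚ) ≠ 0 := by exact_mod_cast h.pos.ne'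
  have h1 := congrArg (fun M => M.map (Int.cast : ℤ → ℚ)) h.matrix_mul_transpose
  have h2 : ((ℓ : ℚ) ^ 2)⁻¹ • (Matrix.of ![α, β, γ]).map (Int.cast : ℤ → ℚ) *
      ((Matrix.of ![α, β, γ]).map (Int.cast : ℤ → ℚ)).transpose = 1 := by
    have h3 := (Matrix.map_mul (L := Matrix.of ![α, β, γ])
      (M := (Matrix.of ![α, β, γ]).transpose) (f := Int.castRingHom ℚ)).symm.trans h1
    rw [Matrix.smul_mul]
    refine (congrArg _ h3).trans ?_
    ext i j
    simp only [Matrix.smul_apply, Matrix.map_apply, Matrix.one_apply, smul_eq_mul]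
    split_ifs <;> simp [hl]
  have h4 := congrArg (fun M => M i j) (mul_eq_one_comm.1 h2)
  rw [Matrix.mul_apply] at h4
  simp only [Fin.sum_univ_three, Matrix.transpose_apply, Matrix.map_apply, Matrix.smul_apply,
    Matrix.of_apply, Matrix.one_apply, smul_eq_mul] at h4
  simp only [Matrix.cons_val] at h4
  have h5 : ((α i * α j + β i * β j + γ i * γ j : ℤ) : ℚ) =
      ((if i = j then (ℓ : ℤ) ^ 2 else 0 : ℤ) : ℚ) := by
    push_cast
    split_ifs at h4 ⊢ <;> field_simp at h4 <;> linarith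
  exact_mod_cast h5

theorem smul_eq (h : IsCubeFrame α β γ ℓ) (y : Fin 3 → ℝ) :
    (ℓ : ℝ) ^ 2 • y = (latticeEmb α ⬝ᵥ y) • latticeEmb α + (latticeEmb β ⬝ᵥ y) • latticeEmb β +
      (latticeEmb γ ⬝ᵥ y) • latticeEmb γ := by
  ext i
  have h1 : ∀ j, (α i * α j + β i * β j + γ i * γ j : ℝ) = if i = j then (ℓ : ℝ) ^ 2 else 0 :=
    fun j => by exact_mod_cast h.transpose_mul_matrix i j
  have h2 : (ℓ : ℝ) ^ 2 * y i =
      ∑ j, (α i * α j + β i * β j + γ i * γ j : ℝ) * y j := by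
    simp [h1]
  simp only [Pi.smul_apply, Pi.add_apply, smul_eq_mul, h2, dotProduct, latticeEmb,
    Fin.sum_univ_three]
  ring

theorem isSimplexFrame (h : IsCubeFrame α β γ ℓ) :
    IsSimplexFrame (facetForm α β γ) (2 * ℓ ^ 2) where
  sum_eq_zero z := by
    simp only [Fin.sum_univ_four, facetForm_apply, Matrix.cons_val]
    ring
  eq_zero z hz := by
    have h1 := hz 1
    have h2 := hz 2
    have h3 := hz 3
    simp only [facetForm_apply, Matrix.cons_val] at h1 h2 h3
    have h4 := h.smul_eq (latticeEmb z)
    rw [dotProduct_latticeEmb, dotProduct_latticeEmb, dotProduct_latticeEmb,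
      show α ⬝ᵥ z = 0 by linarith, show β ⬝ᵥ z = 0 by linarith, show γ ⬝ᵥ z = 0 by linarith] at h4
    have hl : ((ℓ : ℝ) ^ 2) ≠ 0 := pow_ne_zero _ (by exact_mod_cast h.pos.ne')
    simp only [Int.cast_zero, zero_smul, add_zero, smul_eq_zero, hl, false_or] at h4
    funext i
    have := congrFun h4 i
    simpa [latticeEmb] using this
  exists_eq m hm := by
    refine ⟨m 1 • (α + β) + m 2 • (γ + α) + m 3 • (β + γ), fun i => ?_⟩
    rw [Fin.sum_univ_four] at hm
    rw [facetForm_apply]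
    simp only [dotProduct_add, dotProduct_smul, h.αα, h.ββ, h.γγ, h.αβ, h.αγ, h.βγ, h.βα, h.γα,
      h.γβ]
    fin_cases i <;> simp
    · linear_combination (-2 * (ℓ : ℤ) ^ 2) * hm
    all_goals ring

theorem natAbs_det (h : IsCubeFrame α β γ ℓ) : (Matrix.of ![α, β, γ]).det.natAbs = ℓ ^ 3 := by
  have h1 := congrArg Matrix.det h.matrix_mul_transpose
  rw [Matrix.det_mul, Matrix.det_transpose, Matrix.det_smul, Matrix.det_one, Fintype.card_fin,
    mul_one, ← pow_mul, show 2 * 3 = 3 * 2 from rfl, pow_mul, ← sq, ← Int.natAbs_eq_iff_sq_eq] at h1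
  rw [h1, Int.natAbs_pow, Int.natAbs_natCast]

theorem card_quotient (h : IsCubeFrame α β γ ℓ) [NeZero (2 * ℓ ^ 2)] :
    Nat.card ((Fin 3 → ℤ) ⧸ divLattice (facetForm α β γ) (2 * ℓ ^ 2)) = 2 * ℓ ^ 3 := by
  rw [card_quotient_divLattice _ _ h.isSimplexFrame ![α + β, γ + α, β + γ], ← h.natAbs_det]
  · have h1 : (Matrix.of ![α + β, γ + α, β + γ]).det = -2 * (Matrix.of ![α, β, γ]).det := by
      simp [Matrix.det_fin_three]
      ring
    rw [h1, Int.natAbs_mul]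
    rfl
  · intro i j
    rw [facetForm_apply]
    fin_cases i <;> fin_cases j <;>
      simp [h.αα, h.ββ, h.γγ, h.αβ, h.αγ, h.βγ, h.βα, h.γα, h.γβ] <;> ring

theorem facetClassCount_eq (h : IsCubeFrame α β γ ℓ) [NeZero (2 * ℓ ^ 2)] (i : Fin 4) :
    facetClassCount (facetForm α β γ) (2 * ℓ ^ 2) i = ℓ * coordGcd (facetNormal α β γ i) := by
  have hN : 0 < 2 * ℓ ^ 2 := Nat.pos_of_ne_zero (NeZero.ne _)
  have hdvd : coordGcd (facetNormal α β γ i) ∣ 2 * ℓ ^ 2 := by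
    obtain ⟨z, hz⟩ : ∃ z, facetForm α β γ i z = 2 * (ℓ : ℤ) ^ 2 := by
      refine ⟨![-(α + β), α + β, γ + α, β + γ] i, ?_⟩
      rw [facetForm_apply]
      fin_cases i <;> simp [h.αα, h.ββ, h.γγ, h.αβ, h.αγ, h.βγ, h.βα, h.γα, h.γβ] <;> ring
    have := coordGcd_dvd_dotProduct (facetNormal α β γ i) z
    rw [show facetNormal α β γ i ⬝ᵥ z = _ from hz] at this
    exact_mod_cast this
  have h1 := facetClassCount_mul (facetForm α β γ) (2 * ℓ ^ 2) i
    (fun z => coordGcd_dvd_dotProduct (facetNormal α β γ i) z)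
    (exists_dotProduct_eq_coordGcd (facetNormal α β γ i)) hdvd
  rw [h.card_quotient] at h1
  refine Nat.eq_of_mul_eq_mul_right hN (h1.trans ?_)
  ring

theorem facetNormal_dotProduct (α β γ : Fin 3 → ℤ) (y : Fin 3 → ℝ) (i : Fin 4) :
    latticeEmb (facetNormal α β γ i) ⬝ᵥ y =
      ![-(latticeEmb α ⬝ᵥ y + latticeEmb β ⬝ᵥ y + latticeEmb γ ⬝ᵥ y),
        latticeEmb α ⬝ᵥ y + latticeEmb β ⬝ᵥ y - latticeEmb γ ⬝ᵥ y,
        latticeEmb α ⬝ᵥ y - latticeEmb β ⬝ᵥ y + latticeEmb γ ⬝ᵥ y,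
        -(latticeEmb α ⬝ᵥ y) + latticeEmb β ⬝ᵥ y + latticeEmb γ ⬝ᵥ y] i := by
  fin_cases i <;>
    simp [facetNormal, latticeEmb, dotProduct, Fin.sum_univ_three] <;> ring

theorem mem_tetrahedron (h : IsCubeFrame α β γ ℓ) (y : Fin 3 → ℝ) :
    y ∈ tetrahedron α β γ ↔
      ∀ i, 0 ≤ latticeEmb (facetNormal α β γ i) ⬝ᵥ y + if i = 0 then 2 * (ℓ : ℝ) ^ 2 else 0 := by
  have hℓ : (ℓ : ℝ) ≠ 0 := by exact_mod_cast h.pos.ne'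
  have hl : 0 < (ℓ : ℝ) ^ 2 := by positivity
  constructor
  · intro hy i
    have h1 := dotProduct_le_of_mem_latticePolytope (v := -facetNormal α β γ i)
      (c := if i = 0 then 2 * (ℓ : ℤ) ^ 2 else 0) (fun x hx => ?_) hy
    · rw [show -facetNormal α β γ i = (-1 : ℤ) • facetNormal α β γ i by simp, latticeEmb_smul,
        smul_dotProduct] at h1
      push_cast at h1
      rw [smul_eq_mul] at h1
      linarith
    · have h2 : facetNormal α β γ i ⬝ᵥ x = _ := facetForm_apply α β γ x i
      have hl : 0 < (ℓ : ℤ) ^ 2 := pow_pos (by exact_mod_cast h.pos) _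
      rw [neg_dotProduct, h2]
      rcases hx with rfl | rfl | rfl | rfl <;> fin_cases i <;>
        simp [h.αα, h.ββ, h.γγ, h.αβ, h.αγ, h.βγ, h.βα, h.γα, h.γβ] <;> linarith
  · intro hy
    simp only [facetNormal_dotProduct] at hy
    have h0 := hy 0
    have h1 := hy 1
    have h2 := hy 2
    have h3 := hy 3
    have h4 := h.smul_eq y
    generalize latticeEmb α ⬝ᵥ y = a at *
    generalize latticeEmb β ⬝ᵥ y = b at *
    generalize latticeEmb γ ⬝ᵥ y = c at *
    simp only [Matrix.cons_val, if_true, if_false, one_ne_zero, Fin.reduceEq, add_zero]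
      at h0 h1 h2 h3
    have h5 := sum_smul_mem_latticePolytope (V := {0, α + β, β + γ, γ + α})
      ![0, α + β, γ + α, β + γ] (fun i => by fin_cases i <;> simp)
      ![(-(a + b + c) + 2 * (ℓ : ℝ) ^ 2) / (2 * (ℓ : ℝ) ^ 2), (a + b - c) / (2 * (ℓ : ℝ) ^ 2),
        (a - b + c) / (2 * (ℓ : ℝ) ^ 2), (-a + b + c) / (2 * (ℓ : ℝ) ^ 2)]
      (fun i => by fin_cases i <;> exact div_nonneg (by assumption) (by positivity))
      (by
        simp only [Fin.sum_univ_four, Matrix.cons_val]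
        field_simp
        ring)
    refine (congrArg (· ∈ tetrahedron α β γ) (funext fun i => ?_)).mpr h5
    have h6 := congrFun h4 i
    simp only [Pi.smul_apply, Pi.add_apply, smul_eq_mul] at h6
    simp only [Fin.sum_univ_four, Matrix.cons_val, Pi.smul_apply, Pi.add_apply, smul_eq_mul,
      latticeEmb_add]
    have h7 : latticeEmb 0 i = 0 := by simp [latticeEmb]
    rw [h7]
    field_simp
    linear_combination 2 * h6

theorem mem_octahedron (h : IsCubeFrame α β γ ℓ) (y : Fin 3 → ℝ) :
    y ∈ octahedron α β γ ↔ ∀ i, |latticeEmb (facetNormal α β γ i) ⬝ᵥ y| ≤ (ℓ : ℝ) ^ 2 := by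
  have hℓ : (ℓ : ℝ) ≠ 0 := by exact_mod_cast h.pos.ne'
  have hl : 0 < (ℓ : ℝ) ^ 2 := by positivity
  constructor
  · intro hy i
    have hV : ∀ x ∈ ({α, -α, β, -β, γ, -γ} : Set (Fin 3 → ℤ)),
        |facetNormal α β γ i ⬝ᵥ x| ≤ (ℓ : ℤ) ^ 2 := by
      intro x hx
      have h2 : facetNormal α β γ i ⬝ᵥ x = _ := facetForm_apply α β γ x i
      rw [h2, abs_le]
      rcases hx with rfl | rfl | rfl | rfl | rfl | rfl <;> fin_cases i <;>
        simp [h.αα, h.ββ, h.γγ, h.αβ, h.αγ, h.βγ, h.βα, h.γα, h.γβ]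
    have h1 := dotProduct_le_of_mem_latticePolytope (fun x hx => (abs_le.1 (hV x hx)).2) hy
    have h2 := dotProduct_le_of_mem_latticePolytope (v := -facetNormal α β γ i)
      (c := (ℓ : ℤ) ^ 2) (fun x hx => by
        rw [neg_dotProduct]
        exact neg_le.1 (abs_le.1 (hV x hx)).1) hy
    rw [show -facetNormal α β γ i = (-1 : ℤ) • facetNormal α β γ i by simp, latticeEmb_smul,
      smul_dotProduct] at h2
    push_cast at h1 h2
    rw [smul_eq_mul] at h2
    exact abs_le.2 ⟨by linarith, h1⟩
  · intro hy
    simp only [facetNormal_dotProduct, abs_le] at hy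
    obtain ⟨h0, h0'⟩ := hy 0
    obtain ⟨h1, h1'⟩ := hy 1
    obtain ⟨h2, h2'⟩ := hy 2
    obtain ⟨h3, h3'⟩ := hy 3
    have h4 := h.smul_eq y
    generalize latticeEmb α ⬝ᵥ y = a at *
    generalize latticeEmb β ⬝ᵥ y = b at *
    generalize latticeEmb γ ⬝ᵥ y = c at *
    simp only [Matrix.cons_val] at h0 h0' h1 h1' h2 h2' h3 h3'
    have hs : |a| + |b| + |c| ≤ (ℓ : ℝ) ^ 2 := by
      rcases abs_cases a with ha | ha <;> rcases abs_cases b with hb | hb <;>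
        rcases abs_cases c with hc | hc <;> linarith
    obtain ⟨s, hs⟩ : ∃ s, (ℓ : ℝ) ^ 2 - (|a| + |b| + |c|) = 6 * s ∧ 0 ≤ s :=
      ⟨((ℓ : ℝ) ^ 2 - (|a| + |b| + |c|)) / 6, by ring, by linarith⟩
    have ha := abs_le.1 (le_refl |a|)
    have hb := abs_le.1 (le_refl |b|)
    have hc := abs_le.1 (le_refl |c|)
    have h5 := sum_smul_mem_latticePolytope (V := {α, -α, β, -β, γ, -γ})
      ![α, -α, β, -β, γ, -γ] (fun i => by fin_cases i <;> simp)
      (fun i => ![(|a| + a) / 2 + s, (|a| - a) / 2 + s, (|b| + b) / 2 + s, (|b| - b) / 2 + s,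
        (|c| + c) / 2 + s, (|c| - c) / 2 + s] i / (ℓ : ℝ) ^ 2)
      (fun i => div_nonneg (by fin_cases i <;> simp <;> linarith) hl.le)
      (by
        rw [← Finset.sum_div, div_eq_one_iff_eq hl.ne']
        simp only [Fin.sum_univ_six, Matrix.cons_val]
        linarith)
    refine (congrArg (· ∈ octahedron α β γ) (funext fun i => ?_)).mpr h5
    have h6 := congrFun h4 i
    have hneg : ∀ v : Fin 3 → ℤ, latticeEmb (-v) i = -latticeEmb v i := fun v => by
      simp [latticeEmb]
    simp only [Pi.smul_apply, Pi.add_apply, smul_eq_mul] at h6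
    simp only [Fin.sum_univ_six, Matrix.cons_val, Pi.smul_apply, Pi.add_apply, smul_eq_mul, hneg]
    field_simp
    linear_combination 2 * h6

theorem latticeCount_tetrahedron (h : IsCubeFrame α β γ ℓ) {t : ℕ} (ht : 0 < t) :
    latticeCount (tetrahedron α β γ) t = {z | ∀ i, 0 ≤ facetForm α β γ i z +
      (2 * ℓ ^ 2 : ℕ) * (if i = 0 then (t : ℤ) else 0)}.ncard := by
  have ht' : (0 : ℝ) < t := by exact_mod_cast ht
  rw [latticeCount]
  congr 1
  ext z
  rw [Set.mem_ofPred_eq, Set.mem_ofPred_eq, Set.mem_smul_set_iff_inv_smul_mem₀ ht'.ne',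
    h.mem_tetrahedron]
  refine forall_congr' fun i => ?_
  rw [dotProduct_smul, dotProduct_latticeEmb, smul_eq_mul, ← mul_nonneg_iff_of_pos_left ht',
    mul_add, mul_inv_cancel_left₀ ht'.ne']
  have : ((facetNormal α β γ i ⬝ᵥ z : ℤ) : ℝ) + t * (if i = 0 then 2 * (ℓ : ℝ) ^ 2 else 0) =
      ((facetForm α β γ i z + (2 * ℓ ^ 2 : ℕ) * (if i = 0 then (t : ℤ) else 0) : ℤ) : ℝ) := by
    change _ = ((facetNormal α β γ i ⬝ᵥ z + _ : ℤ) : ℝ)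
    split_ifs <;> push_cast <;> ring
  rw [this, Int.cast_nonneg_iff]

theorem latticeCount_octahedron (h : IsCubeFrame α β γ ℓ) {t : ℕ} (ht : 0 < t) :
    latticeCount (octahedron α β γ) t =
      {z | ∀ i, |facetForm α β γ i z| ≤ ((ℓ ^ 2 : ℕ) * t : ℤ)}.ncard := by
  have ht' : (0 : ℝ) < t := by exact_mod_cast ht
  rw [latticeCount]
  congr 1
  ext z
  rw [Set.mem_ofPred_eq, Set.mem_ofPred_eq, Set.mem_smul_set_iff_inv_smul_mem₀ ht'.ne',
    h.mem_octahedron]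
  refine forall_congr' fun i => ?_
  rw [dotProduct_smul, dotProduct_latticeEmb, smul_eq_mul, abs_mul, abs_of_pos (inv_pos.2 ht'),
    inv_mul_le_iff₀ ht', mul_comm (t : ℝ)]
  change _ ↔ |facetNormal α β γ i ⬝ᵥ z| ≤ _
  exact_mod_cast Iff.rfl

theorem latticeCount_tetrahedron' (α β γ : Fin 3 → ℤ) (t : ℕ) :
    latticeCount (tetrahedron' α β γ) t = latticeCount (tetrahedron α β γ) t := by
  rw [tetrahedron, ← latticeCount_image _ (α + β + γ) (ε := -1) rfl, tetrahedron']
  congr 2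
  simp only [Set.image_insert_eq, Set.image_singleton]
  rw [show α + β + γ + (-1 : ℤ) • (0 : Fin 3 → ℤ) = α + β + γ by module,
    show α + β + γ + (-1 : ℤ) • (α + β) = γ by module,
    show α + β + γ + (-1 : ℤ) • (β + γ) = α by module,
    show α + β + γ + (-1 : ℤ) • (γ + α) = β by module]
  ext x
  simp only [Set.mem_insert_iff, Set.mem_singleton_iff]
  tauto

theorem latticeCount_octahedron' (α β γ : Fin 3 → ℤ) (t : ℕ) :
    latticeCount (octahedron' α β γ) t = latticeCount (octahedron α β γ) t := by
  rw [octahedron, ← latticeCount_image _ (α + β + γ) (ε := 1) rfl, octahedron']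
  congr 2
  simp only [Set.image_insert_eq, Set.image_singleton, one_smul]
  rw [show α + β + γ + α = β + γ + 2 • α by abel, show α + β + γ + -α = β + γ by abel,
    show α + β + γ + β = γ + α + 2 • β by abel, show α + β + γ + -β = γ + α by abel,
    show α + β + γ + γ = α + β + 2 • γ by abel, show α + β + γ + -γ = α + β by abel]
  ext x
  simp only [Set.mem_insert_iff, Set.mem_singleton_iff]
  tauto

end IsCubeFrame

theorem eval_cubicWithConstOne (u v w x : ℚ) :
    (cubicWithConstOne u v w).eval x = u * x ^ 3 + v * x ^ 2 + w * x + 1 := by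
  simp [cubicWithConstOne]

theorem IsEhrhartPolynomial.quadratic_coeff_unique {P : Set (Fin 3 → ℝ)} {u v w v' w' : ℚ}
    (h : IsEhrhartPolynomial P (cubicWithConstOne u v w))
    (h' : IsEhrhartPolynomial P (cubicWithConstOne u v' w')) : v = v' := by
  have h1 := (h 1 one_pos).trans (h' 1 one_pos).symm
  have h2 := (h 2 two_pos).trans (h' 2 two_pos).symm
  simp only [eval_cubicWithConstOne] at h1 h2
  push_cast at h1 h2
  linarith

theorem proposition4p1 (α β γ : Fin 3 → ℤ) (ℓ : ℕ) (hℓ : 0 < ℓ)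
    (hα : α ⬝ᵥ α = (ℓ : ℤ) ^ 2) (hβ : β ⬝ᵥ β = (ℓ : ℤ) ^ 2) (hγ : γ ⬝ᵥ γ = (ℓ : ℤ) ^ 2)
    (hαβ : α ⬝ᵥ β = 0) (hαγ : α ⬝ᵥ γ = 0) (hβγ : β ⬝ᵥ γ = 0)
    (T O : Set (Fin 3 → ℝ))
    (hT : T = tetrahedron α β γ ∨ T = tetrahedron' α β γ)
    (hO : O = octahedron α β γ ∨ O = octahedron' α β γ) :
    (∃ μ₁ μ₂ ν₁ ν₂ : ℚ,
      IsEhrhartPolynomial T (cubicWithConstOne ((ℓ : ℚ) ^ 3 / 3) μ₁ μ₂) ∧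
      IsEhrhartPolynomial O (cubicWithConstOne (4 * (ℓ : ℚ) ^ 3 / 3) ν₁ ν₂)) ∧
    ∀ μ₁ μ₂ ν₁ ν₂ : ℚ,
      IsEhrhartPolynomial T (cubicWithConstOne ((ℓ : ℚ) ^ 3 / 3) μ₁ μ₂) →
      IsEhrhartPolynomial O (cubicWithConstOne (4 * (ℓ : ℚ) ^ 3 / 3) ν₁ ν₂) →
      μ₁ = ν₁ / 2 ∧
      ν₁ / 2 = (ℓ : ℚ) * ((coordGcd (α + β + γ) : ℚ) + (coordGcd (α + β - γ) : ℚ) +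
        (coordGcd (α - β + γ) : ℚ) + (coordGcd (-α + β + γ) : ℚ)) / 4 := by
  have h : IsCubeFrame α β γ ℓ := ⟨hℓ, hα, hβ, hγ, hαβ, hαγ, hβγ⟩
  have : NeZero (2 * ℓ ^ 2) := ⟨by positivity⟩
  have hTc : ∀ t, latticeCount T t = latticeCount (tetrahedron α β γ) t := by
    rcases hT with rfl | rfl
    exacts [fun _ => rfl, IsCubeFrame.latticeCount_tetrahedron' α β γ]
  have hOc : ∀ t, latticeCount O t = latticeCount (octahedron α β γ) t := by
    rcases hO with rfl | rfl
    exacts [fun _ => rfl, IsCubeFrame.latticeCount_octahedron' α β γ]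
  set S : ℚ := (ℓ : ℚ) * ((coordGcd (α + β + γ) : ℚ) + (coordGcd (α + β - γ) : ℚ) +
    (coordGcd (α - β + γ) : ℚ) + (coordGcd (-α + β + γ) : ℚ))
  have hSum : ∑ i, (facetClassCount (facetForm α β γ) (2 * ℓ ^ 2) i : ℚ) = S := by
    simp only [h.facetClassCount_eq, Fin.sum_univ_four, facetNormal, Matrix.cons_val, coordGcd_neg]
    push_cast
    ring
  obtain ⟨w, hw⟩ := h.isSimplexFrame.exists_ncard_simplex
  obtain ⟨u, hu⟩ := h.isSimplexFrame.exists_ncard_octahedron (m := ℓ ^ 2) rfl (v := α + β + γ)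
    fun i => by
      rw [IsCubeFrame.facetForm_apply]
      fin_cases i <;> simp [h.αα, h.ββ, h.γγ, h.αβ, h.αγ, h.βγ, h.βα, h.γα, h.γβ]
      ring
  have hET : IsEhrhartPolynomial T (cubicWithConstOne ((ℓ : ℚ) ^ 3 / 3) (S / 4) w) := by
    intro t ht
    rw [hTc, h.latticeCount_tetrahedron ht, hw t _ (by simp), hSum, h.card_quotient,
      eval_cubicWithConstOne]
    push_cast
    ring
  have hEO : IsEhrhartPolynomial O (cubicWithConstOne (4 * (ℓ : ℚ) ^ 3 / 3) (S / 2) u) := by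
    intro t ht
    rw [hOc, h.latticeCount_octahedron ht, hu, hSum, h.card_quotient, eval_cubicWithConstOne]
    push_cast
    ring
  refine ⟨⟨_, _, _, _, hET, hEO⟩, fun μ₁ μ₂ ν₁ ν₂ h1 h2 => ?_⟩
  rw [h1.quadratic_coeff_unique hET, h2.quadratic_coeff_unique hEO]
  constructor <;> ring
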